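/- Let $(X,\mathscr B,\nu)$ be a $\sigma$-finite measure space and let $\mathscr B_{fin}=\{A\in\mathscr B:\nu(A)<\infty\}$. Let $P$ be a Markov kernel on $X$ (each $P(x,\cdot)$ is a probability measure, measurably in $x$) that is reversible with respect to $\nu$, i.e. $\int_A P(x,B)\,d\nu(x)=\int_B P(y,A)\,d\nu(y)$ for all $A,B\in\mathscr B_{fin}$. Put $P_0(x,\cdot)=\delta_x$, $P_{n+1}(x,A)=\int_X P(x,dy)\,P_n(y,A)$ and $G(x,A)=\sum_{n=0}^\infty P_n(x,A)$. Assume that $P$ is transient, i.e. for every $B\in\mathscr B_{fin}$ the series $G(x,B)$ converges for $\nu$-a.e. $x$, and $\int_A G(x,B)\,d\nu(x)<\infty$ for all $A,B\in\mathscr B_{fin}$. For $A,B\in\mathscr B_{fin}$ set $$K(A,B)=\int_A G(x,B)\,d\nu(x).$$ Then $K$ is positive definite on $\mathscr B_{fin}\times\mathscr B_{fin}$: $\sum_{i,j}\alpha_i\alpha_jK(A_i,A_j)\ge 0$ for all $n$, all $\alpha_1,\dots,\alpha_n\in\mathbb R$ and all $A_1,\dots,A_n\in\mathscr B_{fin}$.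 Moreover, the formula $(P_{(\nu)}\varphi)(x)=\int_X\varphi(y)\,P(x,dy)$ (the integral existing for $\nu$-a.e. $x$) defines a self-adjoint operator $P_{(\nu)}$ on the real Hilbert space $L^2(\nu)$ with $\|P_{(\nu)}\|\le 1$. The operator $I-P_{(\nu)}$ has an injective positive square root, so that the (possibly unbounded) operator $(I-P_{(\nu)})^{-1/2}$, the inverse of that square root with domain its range, is well defined, uniquely determined by $I-P_{(\nu)}$. For every $A\in\mathscr B_{fin}$ the indicator function $\chi_A$ lies in the domain of $(I-P_{(\nu)})^{-1/2}$, and the functions $k_A=(I-P_{(\nu)})^{-1/2}\chi_A\in L^2(\nu)$ satisfy $$K(A,B)=\int_X k_A(x)\,k_B(x)\,d\nu(x)\qquad\text{for all }A,B\in\mathscr B_{fin}.$$ -/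

import Mathlib

open MeasureTheory ProbabilityTheory
open scoped ENNReal

namespace TransientMarkov

/-- The measurable sets of finite `ν`-measure. -/
abbrev BFin {X : Type*} [MeasurableSpace X] (ν : Measure X) : Type _ :=
  {A : Set X // MeasurableSet A ∧ ν A < ∞}

/-- Positive definiteness of a real-valued function of two sets of finite measure. -/
def IsPosDefKernel {X : Type*} [MeasurableSpace X] {ν : Measure X}
    (K : BFin ν → BFin ν → ℝ) : Prop :=
  ∀ (n : ℕ) (α : Fin n → ℝ) (A : Fin n → BFin ν),
    0 ≤ ∑ i, ∑ j, α i * α j * K (A i) (A j)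

/-- The system `k` of elements of (real) `L²(ν)` is a realization (factorization) of `K`. -/
def IsL2Realization {X : Type*} [MeasurableSpace X] {ν : Measure X}
    (K : BFin ν → BFin ν → ℝ) (k : BFin ν → Lp ℝ 2 ν) : Prop :=
  ∀ A B : BFin ν, K A B = ∫ x, k A x * k B x ∂ν

/-- Reversibility of a kernel relative to `ν`, tested on sets of finite measure. -/
def Reversible {X : Type*} [MeasurableSpace X] (P : Kernel X X) (ν : Measure X) : Prop :=
  ∀ A B : BFin ν, ∫⁻ x in (A : Set X), P x B ∂ν = ∫⁻ y in (B : Set X), P y A ∂ν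

/-- The Green function `G(x, A) = ∑ₙ Pₙ(x, A)`. Here `P ^ n` is the `n`-step kernel, the power for
composition of kernels: `P ^ 0` sends `x` to the Dirac mass at `x`, and
`(P ^ (n + 1)) x A = ∫⁻ y, (P ^ n) y A ∂(P x)`. -/
noncomputable def green {X : Type*} [MeasurableSpace X] (P : Kernel X X) (x : X) (A : Set X) :
    ℝ≥0∞ :=
  ∑' n : ℕ, (P ^ n) x A

/-- Transience: for each set of finite measure the Green series converges `ν`-almost everywhere,
and its integrals over sets of finite measure are finite. -/
def Transient {X : Type*} [MeasurableSpace X] (P : Kernel X X) (ν : Measure X) : Prop :=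
  (∀ B : BFin ν, ∀ᵐ x ∂ν, green P x B < ∞) ∧
    ∀ A B : BFin ν, ∫⁻ x in (A : Set X), green P x B ∂ν < ∞

/-- The kernel `K(A, B) = ∫_A G(x, B) dν(x)`, a real number for a transient `P`. -/
noncomputable def greenKernel {X : Type*} [MeasurableSpace X] (P : Kernel X X) (ν : Measure X)
    (A B : BFin ν) : ℝ :=
  (∫⁻ x in (A : Set X), green P x B ∂ν).toReal

/-- The indicator function of `A` as an element of `L²(ν)`. -/
noncomputable def chi {X : Type*} [MeasurableSpace X] (ν : Measure X) (A : BFin ν) : Lp ℝ 2 ν :=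
  indicatorConstLp 2 A.2.1 A.2.2.ne (1 : ℝ)

/-- `T` is the operator on `L²(ν)` given by `(T φ)(x) = ∫ φ(y) P(x, dy)`: for every
square-integrable `φ` the integral exists for almost every `x`, and it represents `T φ`. -/
def IsInducedOperator {X : Type*} [MeasurableSpace X] (P : Kernel X X) (ν : Measure X)
    (T : Lp ℝ 2 ν →L[ℝ] Lp ℝ 2 ν) : Prop :=
  ∀ (φ : X → ℝ) (hφ : MemLp φ 2 ν),
    (∀ᵐ x ∂ν, Integrable φ (P x)) ∧ T (hφ.toLp φ) =ᵐ[ν] fun x => ∫ y, φ y ∂(P x)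

/-- `R` is the (possibly unbounded, partially defined) operator `T ^ (-1/2)`: the inverse, with
domain the range of `S`, of an injective positive bounded square root `S` of `T`. -/
def IsInvSqrt {H : Type*} [NormedAddCommGroup H] [InnerProductSpace ℝ H]
    (R : H →ₗ.[ℝ] H) (T : H →L[ℝ] H) : Prop :=
  ∃ S : H →L[ℝ] H, S.IsPositive ∧ S * S = T ∧ Function.Injective S ∧
    R = ((S : H →ₗ[ℝ] H).toPMap ⊤).inverse

end TransientMarkov

/-! Reversibility makes the measure `ν ⊗ₘ P` on `X × X` invariant under the swap. Hence `ν` is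
`P`-invariant and `P` induces a self-adjoint contraction T of L²(ν). Since ⟨χ_A, Tⁿ χ_B⟩ = ∫_A Pₙ(x,
B) dν, K(A, B) is the sum of these numbers, formally ⟨χ_A, (1 - T)⁻¹ χ_B⟩.

Let S be the square root of 1 - T given by its power series, which converges even when ‖T‖ = 1. For
f = χ_A and u_N = ∑_{n<N} Tⁿ f, the inner products ⟨S u_N, S u_M⟩ telescope and converge to K(A, A),
so S u_N is Cauchy with some limit k. Then S k = lim (1 - T) u_N = f - lim T^N f = f. Thus the range
of the self-adjoint S contains every χ_A, so S is injective, and K is the Gram kernel of the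
preimages k_A (`exists_preimages_sqrt`). -/

namespace TransientMarkov

/-! ### The power series of √(1 - z) in a Banach algebra -/

section SquareRoot

open Finset hiding antidiagonal
open Finset.HasAntidiagonal Filter Topology

/-- The closed form bounds the coefficient sums at the boundary of the disc of convergence, so power
boundedness is enough below. -/
theorem sum_range_catalan_div_four_pow (N : ℕ) :
    ∑ n ∈ range N, (catalan n : ℝ) / 4 ^ n = 2 - 2 * (N.centralBinom : ℝ) / 4 ^ N := by
  induction N with
  | zero => simp
  | succ n ih =>
    have h₁ : ((n : ℝ) + 1) * catalan n = n.centralBinom := by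
      exact_mod_cast succ_mul_catalan_eq_centralBinom n
    have h₂ : ((n : ℝ) + 1) * (n + 1).centralBinom = 2 * (2 * n + 1) * n.centralBinom := by
      exact_mod_cast Nat.succ_mul_centralBinom_succ n
    have h₃ : ((n + 1).centralBinom : ℝ) = 2 * (2 * n + 1) * catalan n := by
      rw [← h₁] at h₂
      have h : ((n : ℝ) + 1) ≠ 0 := by positivity
      apply mul_left_cancel₀ h
      rw [h₂]; ring
    rw [sum_range_succ, ih, h₃, ← h₁, pow_succ]
    field_simp
    ring

theorem sum_range_catalan_div_four_pow_le (N : ℕ) :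
    ∑ n ∈ range N, (catalan n : ℝ) / 4 ^ n ≤ 2 := by
  rw [sum_range_catalan_div_four_pow]
  have : 0 ≤ 2 * (N.centralBinom : ℝ) / 4 ^ N := by positivity
  linarith

theorem summable_catalan_div_four_pow : Summable fun n : ℕ => (catalan n : ℝ) / 4 ^ n :=
  summable_of_sum_range_le (fun _ => by positivity) sum_range_catalan_div_four_pow_le

theorem tsum_catalan_div_four_pow_le : ∑' n : ℕ, (catalan n : ℝ) / 4 ^ n ≤ 2 :=
  summable_catalan_div_four_pow.tsum_le_of_sum_range_le sum_range_catalan_div_four_pow_le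

variable {A : Type*} [NormedRing A] [NormedAlgebra ℝ A]

/-- The value at `a` of the power series `∑ₙ catalan n (z / 4) ^ n = 2 (1 - √(1 - z)) / z`. -/
noncomputable def catalanSeries (a : A) : A :=
  ∑' n : ℕ, ((catalan n : ℝ) / 4 ^ n) • a ^ n

theorem norm_catalanSeries_term_le {a : A} (ha : ∀ n : ℕ, ‖a ^ n‖ ≤ 1) (n : ℕ) :
    ‖((catalan n : ℝ) / 4 ^ n) • a ^ n‖ ≤ (catalan n : ℝ) / 4 ^ n := by
  rw [norm_smul, Real.norm_of_nonneg (by positivity)]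
  exact mul_le_of_le_one_right (by positivity) (ha n)

theorem summable_norm_catalanSeries {a : A} (ha : ∀ n : ℕ, ‖a ^ n‖ ≤ 1) :
    Summable fun n : ℕ => ‖((catalan n : ℝ) / 4 ^ n) • a ^ n‖ :=
  .of_nonneg_of_le (fun _ => norm_nonneg _) (norm_catalanSeries_term_le ha)
    summable_catalan_div_four_pow

theorem norm_catalanSeries_le {a : A} (ha : ∀ n : ℕ, ‖a ^ n‖ ≤ 1) : ‖catalanSeries a‖ ≤ 2 :=
  (tsum_of_norm_bounded summable_catalan_div_four_pow.hasSum
    (norm_catalanSeries_term_le ha)).trans tsum_catalan_div_four_pow_le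

/-- The sum of the power series of `√(1 - z)` at `a`. -/
noncomputable def sqrtOneSub (a : A) : A := 1 - (2⁻¹ : ℝ) • (catalanSeries a * a)

theorem norm_one_sub_sqrtOneSub_le {a : A} (ha : ∀ n : ℕ, ‖a ^ n‖ ≤ 1) : ‖1 - sqrtOneSub a‖ ≤ 1 := by
  rw [sqrtOneSub, sub_sub_cancel, norm_smul]
  have h := norm_mul_le (catalanSeries a) a
  have h' := norm_catalanSeries_le ha
  have ha' : ‖a‖ ≤ 1 := by simpa using ha 1
  have : ‖catalanSeries a‖ * ‖a‖ ≤ 2 * 1 := by gcongr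
  norm_num
  linarith

variable [CompleteSpace A]

theorem hasSum_catalanSeries {a : A} (ha : ∀ n : ℕ, ‖a ^ n‖ ≤ 1) :
    HasSum (fun n : ℕ => ((catalan n : ℝ) / 4 ^ n) • a ^ n) (catalanSeries a) :=
  (summable_norm_catalanSeries ha).of_norm.hasSum

theorem commute_catalanSeries {a b : A} (ha : ∀ n : ℕ, ‖a ^ n‖ ≤ 1) (h : Commute b a) :
    Commute b (catalanSeries a) := by
  have h₁ := (hasSum_catalanSeries ha).mul_left b
  have h₂ := (hasSum_catalanSeries ha).mul_right b
  refine h₁.unique ?_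
  convert h₂ using 2 with n
  exact ((h.pow_right n).smul_right _).eq

/-- The Catalan recursion is the Cauchy product of the series with itself. -/
theorem catalanSeries_eq {a : A} (ha : ∀ n : ℕ, ‖a ^ n‖ ≤ 1) :
    catalanSeries a = 1 + (4⁻¹ : ℝ) • (catalanSeries a * catalanSeries a * a) := by
  have hs := summable_norm_catalanSeries ha
  have hterm (n : ℕ) : ∑ ij ∈ antidiagonal n, (((catalan ij.1 : ℝ) / 4 ^ ij.1) • a ^ ij.1) *
      (((catalan ij.2 : ℝ) / 4 ^ ij.2) • a ^ ij.2) =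
      ((catalan (n + 1) : ℝ) / 4 ^ n) • a ^ n := by
    rw [catalan_succ', Nat.cast_sum, sum_div, sum_smul]
    refine sum_congr rfl fun ij hij => ?_
    rw [HasAntidiagonal.mem_antidiagonal] at hij
    rw [smul_mul_smul_comm, ← hij, pow_add, pow_add]
    push_cast
    congr 1
    field_simp
  have hmul := tsum_mul_tsum_eq_tsum_sum_antidiagonal_of_summable_norm hs hs
  have hsum := (summable_norm_sum_mul_antidiagonal_of_summable_norm hs hs).of_norm
  simp only [hterm] at hmul hsum
  change catalanSeries a * catalanSeries a = _ at hmul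
  rw [hmul, ← hsum.tsum_mul_right, ← tsum_const_smul'' (4⁻¹ : ℝ), catalanSeries,
    hs.of_norm.tsum_eq_zero_add]
  congr 1
  · simp
  · refine tsum_congr fun n => ?_
    rw [smul_mul_assoc, ← pow_succ, smul_smul]
    congr 1
    rw [pow_succ]
    field_simp

theorem sqrtOneSub_mul_self {a : A} (ha : ∀ n : ℕ, ‖a ^ n‖ ≤ 1) : sqrtOneSub a * sqrtOneSub a = 1 - a := by
  have hc : Commute a (catalanSeries a) := commute_catalanSeries ha (Commute.refl a)
  have h := congrArg (· * a) (catalanSeries_eq ha)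
  simp only [add_mul, one_mul, smul_mul_assoc] at h
  have h' : catalanSeries a * a * (catalanSeries a * a) =
      (4 : ℝ) • (catalanSeries a * a) - (4 : ℝ) • a := by
    have h₁ : (4 : ℝ) • (catalanSeries a * a) - (4 : ℝ) • a =
        catalanSeries a * catalanSeries a * a * a := by
      rw [← smul_sub]
      nth_rewrite 1 [h]
      rw [add_sub_cancel_left, smul_smul, mul_inv_cancel₀ (by norm_num), one_smul]
    rw [h₁, mul_assoc, ← mul_assoc a, hc.eq]
    simp only [mul_assoc]
  rw [sqrtOneSub, sub_mul, mul_sub, mul_sub, smul_mul_smul_comm, h']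
  simp only [one_mul, mul_one, smul_sub, smul_smul]
  norm_num
  module

theorem commute_sqrtOneSub {a b : A} (ha : ∀ n : ℕ, ‖a ^ n‖ ≤ 1) (h : Commute b a) :
    Commute b (sqrtOneSub a) :=
  (Commute.one_right b).sub_right (((commute_catalanSeries ha h).mul_right h).smul_right _)

end SquareRoot

/-! ### Square roots and Neumann sums of a self-adjoint contraction -/

section HilbertSpace

open Filter Topology

variable {H : Type*} [NormedAddCommGroup H] [InnerProductSpace ℝ H]

theorem norm_pow_le_one {T : H →L[ℝ] H} (hT : ‖T‖ ≤ 1) (n : ℕ) : ‖T ^ n‖ ≤ 1 := by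
  induction n with
  | zero => exact ContinuousLinearMap.norm_id_le
  | succ n ih =>
    rw [pow_succ]
    exact (norm_mul_le _ _).trans (mul_le_one₀ ih (norm_nonneg _) hT)

/-- The cross term in ‖y - S y‖² vanishes, so ‖y‖² + ‖S y‖² ≤ ‖y‖². -/
theorem apply_eq_zero_of_norm_one_sub_le {S : H →L[ℝ] H} (h : ‖1 - S‖ ≤ 1) {y : H}
    (hy : inner ℝ (S y) y = 0) : S y = 0 := by
  have h₁ : ‖y - S y‖ ≤ ‖y‖ := by simpa using (1 - S).le_of_opNorm_le h y
  have h₂ : ‖y - S y‖ ^ 2 ≤ ‖y‖ ^ 2 := by gcongr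
  rw [norm_sub_sq_real, real_inner_comm, hy] at h₂
  have h₃ : ‖S y‖ ^ 2 ≤ 0 := by linarith
  exact norm_eq_zero.1 (pow_eq_zero_iff two_ne_zero |>.1 (le_antisymm h₃ (sq_nonneg _)))

/-- The partial sums of the Neumann series of `T` at `f`. -/
noncomputable def neumannSum (T : H →L[ℝ] H) (f : H) (N : ℕ) : H :=
  ∑ n ∈ Finset.range N, (T ^ n) f

theorem one_sub_neumannSum (T : H →L[ℝ] H) (f : H) (N : ℕ) :
    (1 - T) (neumannSum T f N) = f - (T ^ N) f := by
  induction N with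
  | zero => simp [neumannSum]
  | succ n ih =>
    rw [neumannSum] at ih ⊢
    rw [Finset.sum_range_succ, map_add, ih, pow_succ']
    simp

variable [CompleteSpace H]

theorem isSelfAdjoint_sqrtOneSub {T : H →L[ℝ] H} (hT : IsSelfAdjoint T)
    (hT₁ : ∀ n : ℕ, ‖T ^ n‖ ≤ 1) : IsSelfAdjoint (sqrtOneSub T) := by
  have hC : IsSelfAdjoint (catalanSeries T) := by
    rw [IsSelfAdjoint, catalanSeries, tsum_star]
    refine tsum_congr fun n => ?_
    rw [star_smul, star_trivial, (hT.pow n).star_eq]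
  have hcomm : Commute T (catalanSeries T) := commute_catalanSeries hT₁ (Commute.refl T)
  rw [IsSelfAdjoint, sqrtOneSub, star_sub, star_one, star_smul, star_trivial, star_mul,
    hT.star_eq, hC.star_eq, hcomm.eq]

theorem isPositive_of_norm_one_sub_le {S : H →L[ℝ] H} (hS : IsSelfAdjoint S)
    (h : ‖1 - S‖ ≤ 1) : S.IsPositive := by
  rw [ContinuousLinearMap.isPositive_iff']
  refine ⟨hS, fun x => ?_⟩
  have h₁ : inner ℝ ((1 - S) x) x ≤ ‖x‖ * ‖x‖ :=
    (real_inner_le_norm _ _).trans <| by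
      gcongr
      simpa using (1 - S).le_of_opNorm_le h x
  rw [sub_apply, inner_sub_left, one_apply_eq_self, real_inner_self_eq_norm_mul_norm]
    at h₁
  linarith

theorem isPositive_sqrtOneSub {T : H →L[ℝ] H} (hT : IsSelfAdjoint T) (hT₁ : ‖T‖ ≤ 1) :
    (sqrtOneSub T).IsPositive :=
  isPositive_of_norm_one_sub_le (isSelfAdjoint_sqrtOneSub hT (norm_pow_le_one hT₁))
    (norm_one_sub_sqrtOneSub_le (norm_pow_le_one hT₁))

/-- Write R for the series root. S commutes with T = 1 - S², hence with R, so y = S x - R x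
satisfies (R + S) y = S² x - R² x = 0. Positivity forces ⟨R y, y⟩ = 0, whence R y = 0 and y = 0. -/
theorem eq_sqrtOneSub_of_isPositive {T S : H →L[ℝ] H} (hT : IsSelfAdjoint T) (hT₁ : ‖T‖ ≤ 1)
    (hinj : Function.Injective (sqrtOneSub T : H →L[ℝ] H)) (hS : S.IsPositive) (hST : S * S = 1 - T) :
    S = sqrtOneSub T := by
  have hpow := norm_pow_le_one hT₁
  have hcomm : Commute S (sqrtOneSub T) := by
    refine commute_sqrtOneSub hpow ?_
    have : T = 1 - S * S := by rw [hST]; abel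
    rw [this]
    exact (Commute.one_right S).sub_right ((Commute.refl S).mul_right (Commute.refl S))
  ext x
  set y := S x - sqrtOneSub T x with hy
  have h₀ : sqrtOneSub T y + S y = 0 := by
    have h₁ := DFunLike.congr_fun hcomm.eq x
    have h₂ := DFunLike.congr_fun (hST.trans (sqrtOneSub_mul_self hpow).symm) x
    simp only [mul_apply_eq_comp] at h₁ h₂
    rw [hy, map_sub, map_sub, h₁, h₂]
    abel
  have h₁ := (isPositive_sqrtOneSub hT hT₁).inner_nonneg_left y
  have h₂ := hS.inner_nonneg_left y
  have h₃ : inner ℝ (sqrtOneSub T y) y + inner ℝ (S y) y = 0 := by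
    rw [← inner_add_left, h₀, inner_zero_left]
  have h₄ := apply_eq_zero_of_norm_one_sub_le (norm_one_sub_sqrtOneSub_le hpow)
    (le_antisymm (by linarith) h₁ : inner ℝ (sqrtOneSub T y) y = 0)
  exact sub_eq_zero.1 (hinj (h₄.trans (map_zero _).symm))

theorem inner_pow_apply_pow_apply {T : H →L[ℝ] H} (hT : IsSelfAdjoint T) (f g : H) (m n : ℕ) :
    inner ℝ ((T ^ m) f) ((T ^ n) g) = inner ℝ f ((T ^ (m + n)) g) := by
  rw [(hT.pow m).isSymmetric.apply_clm f ((T ^ n) g), pow_add]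
  rfl

theorem inner_apply_neumannSum {T S : H →L[ℝ] H} (hT : IsSelfAdjoint T) (hS : IsSelfAdjoint S)
    (hST : S * S = 1 - T) (f g : H) (N M : ℕ) :
    inner ℝ (S (neumannSum T f N)) (S (neumannSum T g M)) =
      ∑ n ∈ Finset.range N, inner ℝ f ((T ^ n) g) -
        ∑ n ∈ Finset.range N, inner ℝ f ((T ^ (n + M)) g) := by
  rw [hS.isSymmetric.apply_clm, ← mul_apply_eq_comp, hST, one_sub_neumannSum,
    neumannSum, sum_inner, ← Finset.sum_sub_distrib]
  refine Finset.sum_congr rfl fun n _ => ?_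
  rw [inner_sub_right, inner_pow_apply_pow_apply hT]
  congr 1
  simpa using inner_pow_apply_pow_apply hT f g n 0

theorem tendsto_inner_apply_neumannSum {T S : H →L[ℝ] H} (hT : IsSelfAdjoint T)
    (hS : IsSelfAdjoint S) (hST : S * S = 1 - T) {f g : H} {c : ℝ}
    (h : HasSum (fun n => inner ℝ f ((T ^ n) g)) c) :
    Tendsto (fun p : ℕ × ℕ => inner ℝ (S (neumannSum T f p.1)) (S (neumannSum T g p.2)))
      atTop (𝓝 c) := by
  have hs := h.tendsto_sum_nat
  have h₁ : Tendsto (fun p : ℕ × ℕ => p.1) atTop atTop := by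
    rw [← prod_atTop_atTop_eq]; exact tendsto_fst
  have h₂ : Tendsto (fun p : ℕ × ℕ => p.2) atTop atTop := by
    rw [← prod_atTop_atTop_eq]; exact tendsto_snd
  have h₃ : Tendsto (fun p : ℕ × ℕ => p.2 + p.1) atTop atTop :=
    h₂.atTop_add_atTop h₁
  -- The sum shifted by M is a difference of partial sums, s_{M+N} - s_M, which tends to 0.
  have key := (hs.comp h₁).sub ((hs.comp h₃).sub (hs.comp h₂))
  rw [sub_self, sub_zero] at key
  refine key.congr fun p => ?_
  rw [inner_apply_neumannSum hT hS hST]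
  simp only [Function.comp_apply]
  rw [Finset.sum_range_add, add_sub_cancel_left]
  simp only [add_comm]

theorem exists_tendsto_apply_neumannSum {T S : H →L[ℝ] H} (hT : IsSelfAdjoint T)
    (hS : IsSelfAdjoint S) (hST : S * S = 1 - T) {f : H}
    (h : Summable fun n => inner ℝ f ((T ^ n) f)) :
    ∃ k, S k = f ∧ Tendsto (fun N => S (neumannSum T f N)) atTop (𝓝 k) := by
  obtain ⟨c, hc⟩ := h
  have hlim := tendsto_inner_apply_neumannSum hT hS hST hc
  have hdiag : Tendsto (fun n : ℕ => (n, n)) atTop atTop :=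
    tendsto_atTop_diagonal
  have hcauchy : CauchySeq fun N => S (neumannSum T f N) := by
    rw [cauchySeq_iff_tendsto_dist_atTop_0]
    have hd := hlim.comp hdiag
    have h₁ : Tendsto (fun p : ℕ × ℕ => p.1) atTop atTop := by
      rw [← prod_atTop_atTop_eq]; exact tendsto_fst
    have h₂ : Tendsto (fun p : ℕ × ℕ => p.2) atTop atTop := by
      rw [← prod_atTop_atTop_eq]; exact tendsto_snd
    -- Expanding ‖a - b‖² turns the squared distance into a quantity tending to c - 2c + c = 0.
    have key := (((hd.comp h₁).sub (hlim.const_mul 2)).add (hd.comp h₂)).sqrt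
    have hz : √(c - 2 * c + c) = 0 := by rw [show c - 2 * c + c = 0 by ring, Real.sqrt_zero]
    rw [hz] at key
    refine key.congr fun p => ?_
    simp only [Function.comp_apply]
    rw [real_inner_self_eq_norm_sq, real_inner_self_eq_norm_sq, ← norm_sub_sq_real,
      Real.sqrt_sq (norm_nonneg _), dist_eq_norm]
  obtain ⟨k, hk⟩ := cauchySeq_tendsto_of_complete hcauchy
  refine ⟨k, ?_, hk⟩
  -- ‖T^N f‖² = ⟨f, T^{2N} f⟩ is a term of a convergent series.
  have hpow : Tendsto (fun N => (T ^ N) f) atTop (𝓝 0) := by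
    rw [tendsto_zero_iff_norm_tendsto_zero]
    have h₂ : Tendsto (fun n : ℕ => n + n) atTop atTop :=
      tendsto_id.atTop_add_atTop tendsto_id
    have key := ((hc.summable.tendsto_atTop_zero).comp h₂).sqrt
    rw [Real.sqrt_zero] at key
    refine key.congr fun n => ?_
    rw [Function.comp_apply, ← inner_pow_apply_pow_apply hT, real_inner_self_eq_norm_sq,
      Real.sqrt_sq (norm_nonneg _)]
  have hSk := (S.continuous.tendsto k).comp hk
  have hf : Tendsto (S ∘ fun N => S (neumannSum T f N)) atTop (𝓝 f) := by
    have := (tendsto_const_nhds (x := f)).sub hpow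
    rw [sub_zero] at this
    refine this.congr fun N => ?_
    rw [← one_sub_neumannSum, ← hST]
    rfl
  exact tendsto_nhds_unique hSk hf

theorem exists_preimages_sqrt {ι : Type*} {T S : H →L[ℝ] H} (hT : IsSelfAdjoint T)
    (hS : IsSelfAdjoint S) (hST : S * S = 1 - T) (f : ι → H) (c : ι → ι → ℝ)
    (h : ∀ i j, HasSum (fun n => inner ℝ (f i) ((T ^ n) (f j))) (c i j)) :
    ∃ k : ι → H, (∀ i, S (k i) = f i) ∧ ∀ i j, inner ℝ (k i) (k j) = c i j := by
  have hex (i : ι) := exists_tendsto_apply_neumannSum hT hS hST (h i i).summable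
  choose k hSk hk using hex
  refine ⟨k, hSk, fun i j => ?_⟩
  have h₁ := (hk i).inner (𝕜 := ℝ) (hk j)
  have h₂ := (tendsto_inner_apply_neumannSum hT hS hST (h i j)).comp
    (tendsto_atTop_diagonal (α := ℕ))
  exact tendsto_nhds_unique h₁ h₂

end HilbertSpace

/-! ### The operator on L²(ν) induced by a reversible kernel -/

section MarkovOperator

open Filter Set

variable {X : Type*} [MeasurableSpace X] {ν : Measure X} {P : Kernel X X}

theorem generateFrom_measurableSet_lt_top (ν : Measure X) [SigmaFinite ν] :
    MeasurableSpace.generateFrom {A : Set X | MeasurableSet A ∧ ν A < ∞} = ‹_› := by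
  refine le_antisymm (MeasurableSpace.generateFrom_le fun A hA => hA.1) fun A hA => ?_
  rw [← inter_univ A, ← iUnion_spanningSets ν, inter_iUnion]
  refine MeasurableSet.iUnion fun n => MeasurableSpace.measurableSet_generateFrom
    ⟨hA.inter (measurableSet_spanningSets ν n), ?_⟩
  exact (measure_mono inter_subset_right).trans_lt (measure_spanningSets_lt_top ν n)

theorem isPiSystem_measurableSet_lt_top (ν : Measure X) :
    IsPiSystem {A : Set X | MeasurableSet A ∧ ν A < ∞} := fun _ hA _ hB _ =>
  ⟨hA.1.inter hB.1, (measure_mono inter_subset_left).trans_lt hA.2⟩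

theorem isCountablySpanning_measurableSet_lt_top (ν : Measure X) [SigmaFinite ν] :
    IsCountablySpanning {A : Set X | MeasurableSet A ∧ ν A < ∞} :=
  ⟨spanningSets ν, fun n => ⟨measurableSet_spanningSets ν n, measure_spanningSets_lt_top ν n⟩,
    iUnion_spanningSets ν⟩

theorem isMarkovKernel_pow (P : Kernel X X) [IsMarkovKernel P] (n : ℕ) :
    IsMarkovKernel (P ^ n) := by
  induction n with
  | zero => exact inferInstanceAs (IsMarkovKernel (Kernel.id : Kernel X X))
  | succ n ih => exact inferInstanceAs (IsMarkovKernel ((P ^ n) ∘ₖ P))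

theorem eq_zero_of_inner_chi_eq_zero {φ : Lp ℝ 2 ν}
    (h : ∀ A : BFin ν, inner ℝ (chi ν A) φ = 0) : φ = 0 := by
  refine (Lp.eq_zero_iff_ae_eq_zero).2
    (Lp.ae_eq_zero_of_forall_setIntegral_eq_zero φ two_ne_zero ENNReal.ofNat_ne_top ?_ ?_)
  · intro s hs hνs
    exact integrableOn_Lp_of_measure_ne_top φ Fact.out hνs.ne
  · intro s hs hνs
    have := h ⟨s, hs, hνs⟩
    rwa [chi, L2.inner_indicatorConstLp_one] at this

variable [SigmaFinite ν] [IsMarkovKernel P]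

/-- Reversibility is equality of the two measures on rectangles with sides of finite measure, a
generating π-system. -/
theorem Reversible.map_swap_compProd (hrev : Reversible P ν) :
    (ν ⊗ₘ P).map Prod.swap = ν ⊗ₘ P := by
  symm
  refine Measure.ext_of_generateFrom_of_iUnion
    (image2 (· ×ˢ ·) {A : Set X | MeasurableSet A ∧ ν A < ∞}
      {A : Set X | MeasurableSet A ∧ ν A < ∞})
    (fun n => spanningSets ν n ×ˢ spanningSets ν n) ?_ ?_ ?_ ?_ ?_ ?_
  · exact (generateFrom_eq_prod (generateFrom_measurableSet_lt_top ν)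
      (generateFrom_measurableSet_lt_top ν) (isCountablySpanning_measurableSet_lt_top ν)
      (isCountablySpanning_measurableSet_lt_top ν)).symm
  · exact (isPiSystem_measurableSet_lt_top ν).prod (isPiSystem_measurableSet_lt_top ν)
  · rw [iUnion_prod_of_monotone (monotone_spanningSets ν) (monotone_spanningSets ν),
      iUnion_spanningSets, univ_prod_univ]
  · exact fun n => mem_image2_of_mem
      ⟨measurableSet_spanningSets ν n, measure_spanningSets_lt_top ν n⟩
      ⟨measurableSet_spanningSets ν n, measure_spanningSets_lt_top ν n⟩
  · intro n
    rw [Measure.compProd_apply_prod (measurableSet_spanningSets ν n)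
      (measurableSet_spanningSets ν n)]
    refine ne_of_lt (lt_of_le_of_lt (setLIntegral_mono (g := fun _ => 1) measurable_const
      fun x _ => prob_le_one) ?_)
    simpa using measure_spanningSets_lt_top ν n
  · rintro _ ⟨A, hA, B, hB, rfl⟩
    rw [Measure.map_apply measurable_swap (hA.1.prod hB.1), preimage_swap_prod,
      Measure.compProd_apply_prod hA.1 hB.1, Measure.compProd_apply_prod hB.1 hA.1]
    exact hrev ⟨A, hA⟩ ⟨B, hB⟩

theorem measurePreserving_fst_compProd :
    MeasurePreserving Prod.fst (ν ⊗ₘ P) ν :=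
  ⟨measurable_fst, Measure.fst_compProd ν P⟩

theorem Reversible.measurePreserving_swap (hrev : Reversible P ν) :
    MeasurePreserving Prod.swap (ν ⊗ₘ P) (ν ⊗ₘ P) :=
  ⟨measurable_swap, hrev.map_swap_compProd⟩

theorem Reversible.measurePreserving_snd (hrev : Reversible P ν) :
    MeasurePreserving Prod.snd (ν ⊗ₘ P) ν :=
  measurePreserving_fst_compProd.comp hrev.measurePreserving_swap

theorem Reversible.comp_eq (hrev : Reversible P ν) : P ∘ₘ ν = ν := by
  rw [← Measure.snd_compProd]
  exact hrev.measurePreserving_snd.map_eq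

theorem Reversible.ae_ae (hrev : Reversible P ν) {p : X → Prop} (h : ∀ᵐ y ∂ν, p y) :
    ∀ᵐ x ∂ν, ∀ᵐ y ∂(P x), p y := by
  rw [← hrev.comp_eq] at h
  exact Measure.ae_ae_of_ae_comp h

theorem Reversible.lintegral_lintegral (hrev : Reversible P ν) {f : X → ℝ≥0∞}
    (hf : AEMeasurable f ν) : ∫⁻ x, ∫⁻ y, f y ∂(P x) ∂ν = ∫⁻ y, f y ∂ν := by
  have hf' : AEMeasurable f (P ∘ₘ ν) := by rwa [hrev.comp_eq]
  rw [← Measure.lintegral_bind P.aemeasurable hf', hrev.comp_eq]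

theorem Reversible.ae_memLp (hrev : Reversible P ν) {φ : X → ℝ} (hφ : MemLp φ 2 ν) :
    ∀ᵐ x ∂ν, MemLp φ 2 (P x) := by
  have h₁ : ∀ᵐ x ∂ν, AEStronglyMeasurable φ (P x) := by
    filter_upwards [hrev.ae_ae hφ.1.ae_eq_mk] with x hx
    exact ⟨_, hφ.1.stronglyMeasurable_mk, hx⟩
  have hm : AEMeasurable (fun y => ‖φ y‖ₑ ^ (2 : ℝ)) ν := hφ.1.enorm.pow_const _
  have h₂ : ∀ᵐ x ∂ν, ∫⁻ y, ‖φ y‖ₑ ^ (2 : ℝ) ∂(P x) < ∞ := by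
    refine ae_lt_top' ⟨fun x => ∫⁻ y, hm.mk _ y ∂(P x), hm.measurable_mk.lintegral_kernel, ?_⟩ ?_
    · filter_upwards [hrev.ae_ae hm.ae_eq_mk] with x hx
      exact lintegral_congr_ae hx
    · rw [hrev.lintegral_lintegral hm]
      have := lintegral_rpow_enorm_lt_top_of_eLpNorm_lt_top two_ne_zero ENNReal.ofNat_ne_top hφ.2
      simpa using this.ne
  filter_upwards [h₁, h₂] with x hx₁ hx₂
  exact ⟨hx₁, (eLpNorm_lt_top_iff_lintegral_rpow_enorm_lt_top two_ne_zero
    ENNReal.ofNat_ne_top).2 (by simpa using hx₂)⟩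

theorem Reversible.ae_integrable (hrev : Reversible P ν) {φ : X → ℝ} (hφ : MemLp φ 2 ν) :
    ∀ᵐ x ∂ν, Integrable φ (P x) :=
  (hrev.ae_memLp hφ).mono fun _ hx => hx.integrable one_le_two

theorem Reversible.aestronglyMeasurable_integral (hrev : Reversible P ν) {φ : X → ℝ}
    (hφ : AEStronglyMeasurable φ ν) : AEStronglyMeasurable (fun x => ∫ y, φ y ∂(P x)) ν := by
  refine ⟨fun x => ∫ y, hφ.mk φ y ∂(P x), hφ.stronglyMeasurable_mk.integral_kernel, ?_⟩
  filter_upwards [hrev.ae_ae hφ.ae_eq_mk] with x hx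
  exact integral_congr_ae hx

/-- For the probability `P x`, |∫ φ|² ≤ ∫ φ²; integrating over x and using invariance of `ν` gives
the bound. -/
theorem Reversible.eLpNorm_integral_le (hrev : Reversible P ν) {φ : X → ℝ} (hφ : MemLp φ 2 ν) :
    eLpNorm (fun x => ∫ y, φ y ∂(P x)) 2 ν ≤ eLpNorm φ 2 ν := by
  have hm : AEMeasurable (fun y => ‖φ y‖ₑ ^ (2 : ℝ)) ν := hφ.1.enorm.pow_const _
  rw [eLpNorm_eq_lintegral_rpow_enorm_toReal two_ne_zero ENNReal.ofNat_ne_top,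
    eLpNorm_eq_lintegral_rpow_enorm_toReal two_ne_zero ENNReal.ofNat_ne_top]
  simp only [ENNReal.toReal_ofNat]
  rw [← hrev.lintegral_lintegral hm]
  refine ENNReal.rpow_le_rpow (lintegral_mono_ae ?_) (by norm_num)
  filter_upwards [hrev.ae_memLp hφ] with x hx
  have h₁ : ‖∫ y, φ y ∂(P x)‖ₑ ≤ eLpNorm φ 1 (P x) := by
    rw [eLpNorm_one_eq_lintegral_enorm]
    exact enorm_integral_le_lintegral_enorm _
  have h₂ := h₁.trans (eLpNorm_le_eLpNorm_of_exponent_le one_le_two hx.1)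
  rw [eLpNorm_eq_lintegral_rpow_enorm_toReal two_ne_zero ENNReal.ofNat_ne_top] at h₂
  simp only [ENNReal.toReal_ofNat, one_div] at h₂
  exact (ENNReal.le_rpow_inv_iff two_pos).1 h₂

theorem Reversible.memLp_integral (hrev : Reversible P ν) {φ : X → ℝ} (hφ : MemLp φ 2 ν) :
    MemLp (fun x => ∫ y, φ y ∂(P x)) 2 ν :=
  ⟨hrev.aestronglyMeasurable_integral hφ.1, (hrev.eLpNorm_integral_le hφ).trans_lt hφ.2⟩

/-- The contraction of `L²(ν)` induced by a reversible Markov kernel. -/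
noncomputable def Reversible.operator (hrev : Reversible P ν) : Lp ℝ 2 ν →L[ℝ] Lp ℝ 2 ν :=
  LinearMap.mkContinuous
    { toFun := fun φ => (hrev.memLp_integral (Lp.memLp φ)).toLp _
      map_add' := fun φ ψ => by
        rw [← MemLp.toLp_add, MemLp.toLp_eq_toLp_iff]
        filter_upwards [hrev.ae_ae (Lp.coeFn_add φ ψ), hrev.ae_integrable (Lp.memLp φ),
          hrev.ae_integrable (Lp.memLp ψ)] with x hx h₁ h₂
        rw [integral_congr_ae hx]
        exact integral_add h₁ h₂
      map_smul' := fun c φ => by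
        rw [RingHom.id_apply, ← MemLp.toLp_const_smul, MemLp.toLp_eq_toLp_iff]
        filter_upwards [hrev.ae_ae (Lp.coeFn_smul c φ)] with x hx
        rw [integral_congr_ae hx]
        exact integral_smul c _ }
    1 fun φ => by
      rw [one_mul, LinearMap.coe_mk, AddHom.coe_mk, Lp.norm_toLp, Lp.norm_def]
      exact ENNReal.toReal_mono (Lp.eLpNorm_ne_top φ) (hrev.eLpNorm_integral_le (Lp.memLp φ))

theorem Reversible.norm_operator_le (hrev : Reversible P ν) : ‖hrev.operator‖ ≤ 1 :=
  LinearMap.mkContinuous_norm_le _ zero_le_one _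

theorem Reversible.coeFn_operator (hrev : Reversible P ν) (φ : Lp ℝ 2 ν) :
    hrev.operator φ =ᵐ[ν] fun x => ∫ y, φ y ∂(P x) :=
  MemLp.coeFn_toLp (hrev.memLp_integral (Lp.memLp φ))

theorem Reversible.isInducedOperator (hrev : Reversible P ν) :
    IsInducedOperator P ν hrev.operator := fun φ hφ => by
  refine ⟨hrev.ae_integrable hφ, ?_⟩
  filter_upwards [hrev.coeFn_operator (hφ.toLp φ), hrev.ae_ae hφ.coeFn_toLp] with x hx h
  rw [hx, integral_congr_ae h]

/-- In this form self-adjointness is just swap invariance of `ν ⊗ₘ P`. -/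
theorem Reversible.inner_operator (hrev : Reversible P ν) (φ ψ : Lp ℝ 2 ν) :
    inner ℝ (hrev.operator φ) ψ = ∫ p, φ p.2 * ψ p.1 ∂(ν ⊗ₘ P) := by
  have h₁ : MemLp (fun p : X × X => φ p.2) 2 (ν ⊗ₘ P) :=
    (Lp.memLp φ).comp_measurePreserving hrev.measurePreserving_snd
  have h₂ : MemLp (fun p : X × X => ψ p.1) 2 (ν ⊗ₘ P) :=
    (Lp.memLp ψ).comp_measurePreserving measurePreserving_fst_compProd
  have hprod : Integrable (fun p : X × X => φ p.2 * ψ p.1) (ν ⊗ₘ P) := h₁.integrable_mul h₂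
  rw [Measure.integral_compProd hprod, L2.inner_def]
  refine integral_congr_ae ?_
  filter_upwards [hrev.coeFn_operator φ] with x hx
  simp only [RCLike.inner_apply, conj_trivial, hx]
  rw [integral_mul_const, mul_comm]

theorem Reversible.isSelfAdjoint_operator (hrev : Reversible P ν) :
    IsSelfAdjoint hrev.operator := by
  rw [ContinuousLinearMap.isSelfAdjoint_iff_isSymmetric]
  intro φ ψ
  rw [← real_inner_comm φ]
  change inner ℝ (hrev.operator φ) ψ = inner ℝ (hrev.operator ψ) φ
  rw [hrev.inner_operator, hrev.inner_operator,
    ← hrev.measurePreserving_swap.integral_comp MeasurableEquiv.prodComm.measurableEmbedding]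
  simp [mul_comm]

theorem Reversible.coeFn_operator_pow_chi (hrev : Reversible P ν) (B : BFin ν) (n : ℕ) :
    (hrev.operator ^ n) (chi ν B) =ᵐ[ν] fun x => ((P ^ n) x B).toReal := by
  induction n with
  | zero =>
    refine (indicatorConstLp_coeFn (hs := B.2.1) (hμs := B.2.2.ne)).trans (.of_forall fun x => ?_)
    rw [pow_zero]
    change _ = (Kernel.id x (B : Set X)).toReal
    rw [Kernel.id_apply, Measure.dirac_apply' _ B.2.1]
    by_cases hx : x ∈ (B : Set X) <;> simp [hx]
  | succ n ih =>
    rw [pow_succ']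
    refine (hrev.coeFn_operator _).trans ?_
    filter_upwards [hrev.ae_ae ih] with x hx
    have := isMarkovKernel_pow P n
    rw [ContinuousLinearMap.coe_coe, integral_congr_ae hx, add_comm, Kernel.pow_add_apply_eq_lintegral _ _ _ _ B.2.1, pow_one,
      integral_toReal ((P ^ n).measurable_coe B.2.1).aemeasurable
        (.of_forall fun y => measure_lt_top _ _)]

theorem Reversible.inner_chi_operator_pow_chi (hrev : Reversible P ν) (A B : BFin ν) (n : ℕ) :
    inner ℝ (chi ν A) ((hrev.operator ^ n) (chi ν B)) =
      (∫⁻ x in (A : Set X), (P ^ n) x B ∂ν).toReal := by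
  have := isMarkovKernel_pow P n
  rw [chi, L2.inner_indicatorConstLp_one, ← integral_toReal
    ((P ^ n).measurable_coe B.2.1).aemeasurable (.of_forall fun y => measure_lt_top _ _)]
  exact integral_congr_ae (ae_restrict_of_ae (hrev.coeFn_operator_pow_chi B n))

theorem Reversible.hasSum_inner_chi (hrev : Reversible P ν) (htrans : Transient P ν)
    (A B : BFin ν) :
    HasSum (fun n => inner ℝ (chi ν A) ((hrev.operator ^ n) (chi ν B))) (greenKernel P ν A B) := by
  have h := htrans.2 A B
  have heq : ∫⁻ x in (A : Set X), green P x B ∂ν =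
      ∑' n, ∫⁻ x in (A : Set X), (P ^ n) x B ∂ν :=
    lintegral_tsum fun n => ((P ^ n).measurable_coe B.2.1).aemeasurable
  simp only [hrev.inner_chi_operator_pow_chi]
  rw [heq] at h
  rw [greenKernel, heq, ENNReal.tsum_toReal_eq (ENNReal.ne_top_of_tsum_ne_top h.ne)]
  exact (ENNReal.summable_toReal h.ne).hasSum

end MarkovOperator

end TransientMarkov

open TransientMarkov in
theorem mainTheorem4 {X : Type*} [MeasurableSpace X] (ν : Measure X) [SigmaFinite ν]
    (P : Kernel X X) [IsMarkovKernel P] (hrev : Reversible P ν) (htrans : Transient P ν) :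
    IsPosDefKernel (greenKernel P ν) ∧
      ∃ Pν : Lp ℝ 2 ν →L[ℝ] Lp ℝ 2 ν,
        IsInducedOperator P ν Pν ∧ IsSelfAdjoint Pν ∧ ‖Pν‖ ≤ 1 ∧
          ∃ R : Lp ℝ 2 ν →ₗ.[ℝ] Lp ℝ 2 ν,
            IsInvSqrt R (1 - Pν) ∧ (∀ R', IsInvSqrt R' (1 - Pν) → R' = R) ∧
              ∃ hdom : ∀ A : BFin ν, chi ν A ∈ R.domain,
                IsL2Realization (greenKernel P ν) (fun A => R ⟨chi ν A, hdom A⟩) := by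
  have hT := hrev.isSelfAdjoint_operator
  have hT₁ := hrev.norm_operator_le
  have hpow := norm_pow_le_one hT₁
  set S := sqrtOneSub hrev.operator
  have hS : S.IsPositive := isPositive_sqrtOneSub hT hT₁
  have hSS : S * S = 1 - hrev.operator := sqrtOneSub_mul_self hpow
  obtain ⟨k, hSk, hk⟩ := exists_preimages_sqrt hT hS.isSelfAdjoint hSS (chi ν) (greenKernel P ν)
    (hrev.hasSum_inner_chi htrans)
  -- If S φ = 0, then ⟨χ_A, φ⟩ = ⟨S k_A, φ⟩ = ⟨k_A, S φ⟩ = 0 for every A.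
  have hinj : Function.Injective S := by
    refine (injective_iff_map_eq_zero S).2 fun φ hφ => eq_zero_of_inner_chi_eq_zero fun A => ?_
    rw [← hSk A, hS.inner_left_eq_inner_right, hφ, inner_zero_right]
  have hker : LinearMap.ker (((S : Lp ℝ 2 ν →ₗ[ℝ] Lp ℝ 2 ν).toPMap ⊤).toFun) = ⊥ :=
    LinearMap.ker_eq_bot.2 fun x y hxy => Subtype.ext (hinj hxy)
  have hdom : ∀ A : BFin ν,
      chi ν A ∈ ((S : Lp ℝ 2 ν →ₗ[ℝ] Lp ℝ 2 ν).toPMap ⊤).inverse.domain := fun A => by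
    rw [LinearPMap.inverse_domain]
    exact ⟨⟨k A, trivial⟩, hSk A⟩
  have hval (A : BFin ν) :
      ((S : Lp ℝ 2 ν →ₗ[ℝ] Lp ℝ 2 ν).toPMap ⊤).inverse ⟨chi ν A, hdom A⟩ = k A :=
    LinearPMap.inverse_apply_eq hker (x := ⟨k A, trivial⟩) (hSk A)
  refine ⟨fun n α A => ?_, hrev.operator, hrev.isInducedOperator, hT, hT₁, _,
    ⟨S, hS, hSS, hinj, rfl⟩, ?_, hdom, fun A B => ?_⟩
  -- The quadratic form of K is ‖∑ αᵢ k_{Aᵢ}‖².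
  · have h := real_inner_self_nonneg (x := ∑ i, α i • k (A i))
    simp only [sum_inner, inner_sum, real_inner_smul_left, real_inner_smul_right, hk] at h
    rw [Finset.sum_comm] at h
    simpa only [mul_assoc, mul_left_comm] using h
  · rintro _ ⟨S', hS', hSS', -, rfl⟩
    rw [eq_sqrtOneSub_of_isPositive hT hT₁ hinj hS' hSS']
  · simp only [hval]
    rw [← hk, L2.inner_def]
    refine integral_congr_ae (.of_forall fun x => ?_)
    simp [mul_comm]
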